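/- Let $\Bbbk$ be a field of characteristic $0$, let $d\ge 2$, and let $\Delta$ be an abstract simplicial complex on a finite vertex set $V$ (a non-empty family of subsets of $V$ closed under taking subsets) that is a $(d-1)$-dimensional pseudomanifold without boundary. With $e=d-1$ this means: (i) every facet (maximal face) of $\Delta$ is an $e$-simplex (a face with $e+1$ elements); (ii) if $e>1$, every $(e-1)$-simplex of $\Delta$ is contained in at least one and at most two $e$-simplices; (iii) any two $e$-simplices $F,F'$ are joined by a chain $F=F_1,\dots,F_m=F'$ of $e$-simplices such that each $F_i\cap F_{i+1}$ is an $(e-1)$-simplex; and (iv) no $(e-1)$-simplex is contained in exactly one $e$-simplex. Assume that the dual graph of $\Delta$, whose vertices are the facets and in which two distinct facets are adjacent if and only if they share an $(e-1)$-face, is bipartite. Let $$R=A(\Delta)=\Bbbk[x_v : v\in V]\Big/\Big(\langle x_v^2 : v\in V\rangle+\big\langle \textstyle\prod_{v\in F}x_v : F\subseteq V,\ F\notin\Delta\big\rangle\Big)$$ with its standard grading, let $\omega_R=\operatorname{Hom}_{\Bbbk}(R,\Bbbk)$ be its graded canonical module, with $(r\varphi)(s)=\varphi(rs)$ and $(\omega_R)_n=\operatorname{Hom}_{\Bbbk}(R_{-n},\Bbbk)$,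 and let $\tilde R=R\ltimes\omega_R(-d-1)$ be the Nagata idealization, that is, $R\oplus\omega_R$ with the product $(r,\varphi)(s,\psi)=(rs,\,r\psi+s\varphi)$ and the grading $\tilde R_i=R_i\oplus(\omega_R)_{i-d-1}$, $i\ge 0$. Then $\tilde R$ is a standard graded Artinian Gorenstein $\Bbbk$-algebra (that is, it is an Artinian graded algebra with $\tilde R_0=\Bbbk$, generated over $\Bbbk$ by the finite-dimensional space $\tilde R_1$, and its socle $(0:\tilde R_{\ge 1})$ is one-dimensional over $\Bbbk$), and $\tilde R$ fails the weak Lefschetz property in degree $d-1$: for no linear form $\ell\in\tilde R_1$ is the multiplication map $\ell:\tilde R_{d-1}\to\tilde R_d$ injective or surjective. -/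

import Mathlib

/-- An abstract simplicial complex on the vertex set `V`: a non-empty, downward closed family of
finite subsets of `V` (so the empty set is a face; a vertex of `V` need not be a face). -/
structure SimplicialCx (V : Type*) where
  faces : Set (Finset V)
  nonempty : faces.Nonempty
  down_closed : ∀ ⦃E F : Finset V⦄, E ∈ faces → F ⊆ E → F ∈ faces

namespace SimplicialCx

variable {V : Type*} (Δ : SimplicialCx V)

/-- `F` is a facet: a face that is maximal under inclusion. -/
def IsFacet (F : Finset V) : Prop := Maximal (· ∈ Δ.faces) F

/-- `F` is a face with `m` vertices, that is, a face of dimension `m - 1`. -/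
def IsFaceOfCard (m : ℕ) (F : Finset V) : Prop := F ∈ Δ.faces ∧ F.card = m

/-- The set of `e`-simplices (faces with `e + 1` vertices) that contain `E`. -/
def simplicesAbove (e : ℕ) (E : Finset V) : Set (Finset V) :=
  {F | Δ.IsFaceOfCard (e + 1) F ∧ E ⊆ F}

/-- `Δ` is an `e`-dimensional pseudomanifold. An `e`-simplex has `e + 1` vertices and an
`(e - 1)`-simplex has `e` vertices. -/
structure IsPseudomanifold [DecidableEq V] (e : ℕ) : Prop where
  /-- Each facet is an `e`-simplex. -/
  pure : ∀ F, Δ.IsFacet F → F.card = e + 1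
  /-- For `e > 1`, each `(e - 1)`-simplex lies in one or two `e`-simplices. -/
  ridge : 1 < e → ∀ E, Δ.IsFaceOfCard e E →
    1 ≤ (Δ.simplicesAbove e E).ncard ∧ (Δ.simplicesAbove e E).ncard ≤ 2
  /-- Any two `e`-simplices are joined by a chain of `e`-simplices in which consecutive ones
  intersect in an `(e - 1)`-simplex. -/
  chain : ∀ F G, Δ.IsFaceOfCard (e + 1) F → Δ.IsFaceOfCard (e + 1) G →
    Relation.ReflTransGen
      (fun A B => Δ.IsFaceOfCard (e + 1) A ∧ Δ.IsFaceOfCard (e + 1) B ∧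
        Δ.IsFaceOfCard e (A ∩ B)) F G

/-- `E` is a boundary `(e - 1)`-simplex: it lies in exactly one `e`-simplex. -/
def IsBoundaryRidge (e : ℕ) (E : Finset V) : Prop :=
  Δ.IsFaceOfCard e E ∧ (Δ.simplicesAbove e E).ncard = 1

/-- `Δ` is an `e`-dimensional pseudomanifold without boundary: no `e`-simplex has a boundary
`(e - 1)`-simplex as a face. -/
structure IsPseudomanifoldWithoutBoundary [DecidableEq V] (e : ℕ) : Prop
    extends Δ.IsPseudomanifold e where
  no_boundary : ∀ F E, Δ.IsFaceOfCard (e + 1) F → E ⊆ F → ¬ Δ.IsBoundaryRidge e E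

/-- The dual graph of the pure `e`-dimensional complex `Δ`: the vertices are the facets, and two
different facets are adjacent when they share a ridge, that is, an `(e - 1)`-face. -/
def dualGraph (e : ℕ) : SimpleGraph {F : Finset V // Δ.IsFacet F} where
  Adj F G := F ≠ G ∧ ∃ E, Δ.IsFaceOfCard e E ∧ E ⊆ F.1 ∧ E ⊆ G.1
  symm := ⟨fun _ _ h => ⟨h.1.symm, h.2.imp fun _ hE => ⟨hE.1, hE.2.2, hE.2.1⟩⟩⟩
  loopless := ⟨fun _ h => h.1 rfl⟩

variable (k : Type*) [Field k]

/-- The Stanley-Reisner ideal `I_Δ`, generated by the products of variables over non-faces. -/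
noncomputable def stanleyReisnerIdeal : Ideal (MvPolynomial V k) :=
  Ideal.span {p | ∃ F : Finset V, F ∉ Δ.faces ∧ p = ∏ i ∈ F, MvPolynomial.X i}

/-- The ideal `J_Δ`, generated by the squares of the variables and `I_Δ`. -/
noncomputable def sqIdeal : Ideal (MvPolynomial V k) :=
  Ideal.span (Set.range fun i : V => (MvPolynomial.X i : MvPolynomial V k) ^ 2) ⊔
    Δ.stanleyReisnerIdeal k

/-- The algebra `A(Δ) = k[x_v : v ∈ V] / J_Δ`. -/
abbrev A : Type _ := MvPolynomial V k ⧸ Δ.sqIdeal k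

/-- The degree `i` part of `A(Δ)`: the classes of the homogeneous polynomials of degree `i`. -/
noncomputable def gradingA (i : ℕ) : Submodule k (Δ.A k) :=
  (MvPolynomial.homogeneousSubmodule V k i).map (Ideal.Quotient.mkₐ k (Δ.sqIdeal k)).toLinearMap

end SimplicialCx

section Canonical

variable (k R : Type*) [Field k] [CommRing R] [Algebra k R]

/-- The canonical module `ω_R = Hom_k(R, k)` of an Artinian graded `k`-algebra `R` (a
finite-dimensional one, so that the graded dual is the whole dual). -/
def CanonicalModule : Type _ := Module.Dual k R

namespace CanonicalModule

noncomputable instance : AddCommGroup (CanonicalModule k R) :=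
  inferInstanceAs (AddCommGroup (Module.Dual k R))

noncomputable instance : Module k (CanonicalModule k R) :=
  inferInstanceAs (Module k (Module.Dual k R))

instance : FunLike (CanonicalModule k R) R k :=
  inferInstanceAs (FunLike (Module.Dual k R) R k)

variable {k R}

theorem ext_iff' {φ ψ : CanonicalModule k R} : φ = ψ ↔ ∀ s, φ s = ψ s :=
  LinearMap.ext_iff

theorem add_apply (φ ψ : CanonicalModule k R) (s : R) : (φ + ψ) s = φ s + ψ s := rfl

theorem zero_apply (s : R) : (0 : CanonicalModule k R) s = 0 := rfl

theorem smul_apply (c : k) (φ : CanonicalModule k R) (s : R) : (c • φ) s = c * φ s := rfl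

theorem apply_add (φ : CanonicalModule k R) (s t : R) : φ (s + t) = φ s + φ t :=
  LinearMap.map_add φ s t

theorem apply_zero (φ : CanonicalModule k R) : φ 0 = 0 := LinearMap.map_zero φ

theorem apply_smul (φ : CanonicalModule k R) (c : k) (s : R) : φ (c • s) = c * φ s :=
  LinearMap.map_smul φ c s

/-- The `R`-module structure on `ω_R`: `(r • φ) s = φ (r * s)`. -/
noncomputable instance : Module R (CanonicalModule k R) where
  smul r φ := LinearMap.comp (φ : Module.Dual k R) (LinearMap.mulLeft k r)
  one_smul φ := ext_iff'.2 fun s => congrArg φ (one_mul s)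
  mul_smul r t φ := ext_iff'.2 fun s => congrArg φ (by
    change r * t * s = t * (r * s)
    ring)
  smul_zero _ := rfl
  smul_add _ _ _ := rfl
  add_smul r t φ := ext_iff'.2 fun s =>
    (congrArg φ (add_mul r t s)).trans (apply_add φ (r * s) (t * s))
  zero_smul φ := ext_iff'.2 fun s => (congrArg φ (zero_mul s)).trans (apply_zero φ)

theorem ring_smul_apply (r : R) (φ : CanonicalModule k R) (s : R) : (r • φ) s = φ (r * s) := rfl

/-- The same action from the right, as `R` is commutative. -/
noncomputable instance : Module Rᵐᵒᵖ (CanonicalModule k R) :=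
  Module.compHom (CanonicalModule k R) ((RingHom.id R).fromOpposite fun _ _ => mul_comm _ _)

instance : IsCentralScalar R (CanonicalModule k R) := ⟨fun _ _ => rfl⟩

instance : IsScalarTower k R (CanonicalModule k R) :=
  ⟨fun c r φ => ext_iff'.2 fun s =>
    (congrArg φ (smul_mul_assoc c r s)).trans (apply_smul φ c (r * s))⟩

instance : IsScalarTower k Rᵐᵒᵖ (CanonicalModule k R) :=
  ⟨fun c r φ => smul_assoc c r.unop φ⟩

/-- The degree `n` part of `ω_R` is `Hom_k(R_{-n}, k)`: the functionals that vanish on all `R_j`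
with `j ≠ -n`. -/
def grading (ℛ : ℕ → Submodule k R) (n : ℤ) : Submodule k (CanonicalModule k R) where
  carrier := {φ | ∀ j : ℕ, (j : ℤ) ≠ -n → ∀ r ∈ ℛ j, φ r = 0}
  add_mem' {φ ψ} hφ hψ := fun j hj r hr => by rw [add_apply, hφ j hj r hr, hψ j hj r hr, add_zero]
  zero_mem' := fun _ _ _ _ => rfl
  smul_mem' c φ hφ := fun j hj r hr => by rw [smul_apply, hφ j hj r hr, mul_zero]

end CanonicalModule

/-- The Nagata idealization `R ⋉ ω_R`, with the multiplication
`(r, φ) (s, ψ) = (r s, r ψ + s φ)`. -/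
abbrev Idealization : Type _ := TrivSqZeroExt R (CanonicalModule k R)

variable {k R}

/-- The grading of `R ⋉ ω_R(a)`: its degree `i` part is `R_i ⊕ ω_R(a)_i`, where
`ω_R(a)_i = (ω_R)_{a + i}`. -/
noncomputable def idealizationGrading (ℛ : ℕ → Submodule k R) (a : ℤ) (i : ℕ) :
    Submodule k (Idealization k R) where
  carrier := {x | x.fst ∈ ℛ i ∧ x.snd ∈ CanonicalModule.grading ℛ (a + i)}
  add_mem' hx hy := ⟨add_mem hx.1 hy.1, add_mem hx.2 hy.2⟩
  zero_mem' := ⟨zero_mem _, zero_mem _⟩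
  smul_mem' c _ hx := ⟨Submodule.smul_mem _ c hx.1, Submodule.smul_mem _ c hx.2⟩

end Canonical

section Graded

variable {k B : Type*} [Field k] [CommRing B] [Algebra k B] (𝒜 : ℕ → Submodule k B)

/-- `B = ⨁ 𝒜 i` is a standard graded `k`-algebra: a graded algebra with `𝒜 0 = k`, generated over
`k` by the finite-dimensional space `𝒜 1`. -/
structure IsStandardGraded : Prop where
  gradedMonoid : SetLike.GradedMonoid 𝒜
  isInternal : DirectSum.IsInternal 𝒜
  degree_zero : 𝒜 0 = 1
  finite_one : Module.Finite k (𝒜 1)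
  adjoin_one : Algebra.adjoin k (𝒜 1 : Set B) = ⊤

/-- The socle `(0 : 𝒜_{≥ 1})`. -/
def gradedSocle : Submodule k B where
  carrier := {x | ∀ n : ℕ, 1 ≤ n → ∀ a ∈ 𝒜 n, a * x = 0}
  add_mem' hx hy := fun n hn a ha => by rw [mul_add, hx n hn a ha, hy n hn a ha, add_zero]
  zero_mem' := fun _ _ a _ => mul_zero a
  smul_mem' c x hx := fun n hn a ha => by rw [mul_smul_comm, hx n hn a ha, smul_zero]

/-- A standard graded Artinian `k`-algebra is Gorenstein when its socle is one-dimensional. -/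
structure IsArtinianGorenstein : Prop where
  standardGraded : IsStandardGraded 𝒜
  artinian : IsArtinianRing B
  socle : Module.finrank k (gradedSocle 𝒜) = 1

/-- The weak Lefschetz property in degree `i`: for some linear form `ℓ` (equivalently, over an
infinite field, for a general one) the multiplication `ℓ : 𝒜 i → 𝒜 (i + 1)` has maximal rank, that
is, it is injective or surjective. -/
def HasWLPInDegree (i : ℕ) : Prop :=
  ∃ l ∈ 𝒜 1, (∀ x ∈ 𝒜 i, l * x = 0 → x = 0) ∨ (∀ y ∈ 𝒜 (i + 1), ∃ x ∈ 𝒜 i, l * x = y)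

end Graded

/-! The squarefree monomials `x_F`, `F ∈ Δ`, form a basis of `R = A(Δ)`, and multiplication is
disjoint union or zero. The dual basis of `ω_R` satisfies `x_{G \ F} • G* = F*` for `F ⊆ G`. Purity
therefore makes `R` level: `ω_R` is generated by the duals of the facets, which the shift puts in
degree 1. This gives standard grading, and a socle spanned by the dual of the empty face.

For the Lefschetz part, let `ℓ = (a, ψ)` with `a = ∑ α_v x_v`. Everything rests on a nonzero
functional `φ` on `R_d` with `a • φ = 0` (`exists_canonical_annihilated`). Such a `φ` kills `a
R_{d-1}`, so `ℓ` is not surjective onto degree `d`; and a suitable nonzero multiple `x_{F \ T} • φ`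
lies in degree `d - 1` of the idealization and is killed by `ℓ`, so `ℓ` is not injective.

To find `φ`, its values `c F` on facets must satisfy `∑ α_v c(E ∪ v) = 0` over each ridge `E`. A
ridge lies in exactly two facets, of opposite colours (`exists_facet_sign`). If no `α_v` vanishes,
`c F = ± ∏_{v ∈ F} α_v⁻¹` works. In general (`exists_facet_weight`) the vanishing factors are
dropped and `c` is supported on the facets whose set of vertices with `α_v = 0` is a fixed one of
maximal size. This treats every linear form directly, with no genericity argument. -/

namespace SimplicialCx

/-! ### The monomial basis of `A(Δ)` and its coordinates -/

open MvPolynomial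

variable {V : Type*} (Δ : SimplicialCx V) (k : Type*) [Field k]

/-- The squarefree monomial `x_F = ∏_{v ∈ F} x_v` in `A(Δ)`. -/
noncomputable def faceMonomial (F : Finset V) : Δ.A k :=
  Ideal.Quotient.mkₐ k (Δ.sqIdeal k) (∏ i ∈ F, X i)

theorem prod_X_eq_monomial (F : Finset V) :
    (∏ i ∈ F, X i : MvPolynomial V k) = monomial (∑ i ∈ F, Finsupp.single i 1) 1 := by
  rw [monomial_sum_one]
  rfl

theorem sum_single_apply [DecidableEq V] (F : Finset V) (v : V) :
    (∑ i ∈ F, Finsupp.single i 1 : V →₀ ℕ) v = if v ∈ F then 1 else 0 := by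
  simp [Finsupp.finsetSum_apply, Finsupp.single_apply]

theorem sum_single_injective :
    Function.Injective fun F : Finset V => (∑ i ∈ F, Finsupp.single i 1 : V →₀ ℕ) := by
  classical
  intro F G h
  ext v
  have := DFunLike.congr_fun h v
  simp only [sum_single_apply] at this
  by_cases h1 : v ∈ F <;> by_cases h2 : v ∈ G <;> simp_all

/-- The coefficients at faces vanish on `J_Δ`. -/
theorem coeff_eq_zero_of_mem_sqIdeal {F : Finset V} (hF : F ∈ Δ.faces) {p : MvPolynomial V k}
    (hp : p ∈ Δ.sqIdeal k) : coeff (∑ i ∈ F, Finsupp.single i 1) p = 0 := by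
  classical
  rw [sqIdeal, stanleyReisnerIdeal, ← Ideal.span_union] at hp
  -- The multiplier `q` lets the span induction pass through ideal multiples.
  suffices h : ∀ q, coeff (∑ i ∈ F, Finsupp.single i 1) (q * p) = 0 by simpa using h 1
  refine Submodule.span_induction ?_ ?_ ?_ ?_ hp
  · rintro _ (⟨v, rfl⟩ | ⟨G, hG, rfl⟩) q
    · dsimp only
      rw [X_pow_eq_monomial, coeff_mul_monomial', if_neg]
      intro h
      have := h v
      rw [sum_single_apply, Finsupp.single_eq_same] at this
      split_ifs at this <;> omega
    · rw [prod_X_eq_monomial, coeff_mul_monomial', if_neg]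
      intro h
      refine hG (Δ.down_closed hF fun v hv => ?_)
      have := h v
      rw [sum_single_apply, sum_single_apply, if_pos hv] at this
      by_contra hv'
      simp [hv'] at this
  · simp
  · intro x y _ _ hx hy q
    rw [mul_add, coeff_add, hx, hy, add_zero]
  · intro r x _ hx q
    rw [smul_eq_mul, ← mul_assoc, hx]

open Classical in
/-- The coefficient of `x_F` in an element of `A(Δ)`; it is zero by convention when `F` is not
a face. -/
noncomputable def faceCoeff (F : Finset V) : Δ.A k →ₗ[k] k :=
  if hF : F ∈ Δ.faces then
    (Submodule.liftQ ((Δ.sqIdeal k).restrictScalars k)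
      (lcoeff k (∑ i ∈ F, Finsupp.single i 1))
      fun _ hp => Δ.coeff_eq_zero_of_mem_sqIdeal k hF hp) ∘ₗ
    (Submodule.Quotient.restrictScalarsEquiv k (Δ.sqIdeal k)).symm.toLinearMap
  else 0

variable {Δ k}

theorem faceCoeff_mk {F : Finset V} (hF : F ∈ Δ.faces) (p : MvPolynomial V k) :
    Δ.faceCoeff k F (Ideal.Quotient.mkₐ k (Δ.sqIdeal k) p) =
      coeff (∑ i ∈ F, Finsupp.single i 1) p := by
  rw [faceCoeff, dif_pos hF]
  rfl

theorem faceCoeff_of_notMem {F : Finset V} (hF : F ∉ Δ.faces) (a : Δ.A k) :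
    Δ.faceCoeff k F a = 0 := by
  rw [faceCoeff, dif_neg hF]
  rfl

theorem faceMonomial_of_notMem {F : Finset V} (hF : F ∉ Δ.faces) : Δ.faceMonomial k F = 0 :=
  Ideal.Quotient.eq_zero_iff_mem.2 <| Ideal.mem_sup_right <| Ideal.subset_span ⟨F, hF, rfl⟩

theorem faceMonomial_empty : Δ.faceMonomial k ∅ = 1 := by
  simp [faceMonomial]

theorem faceMonomial_mul_of_disjoint [DecidableEq V] {F G : Finset V} (h : Disjoint F G) :
    Δ.faceMonomial k F * Δ.faceMonomial k G = Δ.faceMonomial k (F ∪ G) := by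
  rw [faceMonomial, faceMonomial, ← map_mul, ← Finset.prod_union h]
  rfl

theorem mk_eq_zero_of_sq_dvd {p : MvPolynomial V k} {v : V} (h : X v ^ 2 ∣ p) :
    Ideal.Quotient.mkₐ k (Δ.sqIdeal k) p = 0 :=
  Ideal.Quotient.eq_zero_iff_mem.2 <| Ideal.mem_sup_left <|
    Ideal.mem_of_dvd _ h (Ideal.subset_span ⟨v, rfl⟩)

theorem faceMonomial_mul_of_not_disjoint {F G : Finset V} (h : ¬ Disjoint F G) :
    Δ.faceMonomial k F * Δ.faceMonomial k G = 0 := by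
  obtain ⟨v, hF, hG⟩ := Finset.not_disjoint_iff.1 h
  rw [faceMonomial, faceMonomial, ← map_mul]
  refine mk_eq_zero_of_sq_dvd (v := v) ?_
  rw [sq]
  exact mul_dvd_mul (Finset.dvd_prod_of_mem _ hF) (Finset.dvd_prod_of_mem _ hG)

theorem faceCoeff_faceMonomial [DecidableEq V] {F : Finset V} (hF : F ∈ Δ.faces) (G : Finset V) :
    Δ.faceCoeff k F (Δ.faceMonomial k G) = if F = G then 1 else 0 := by
  rw [faceMonomial, faceCoeff_mk hF, prod_X_eq_monomial, coeff_monomial]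
  simp only [sum_single_injective.eq_iff, eq_comm]

theorem faceMonomial_mem_gradingA (F : Finset V) :
    Δ.faceMonomial k F ∈ Δ.gradingA k F.card := by
  refine ⟨_, ?_, rfl⟩
  have := IsHomogeneous.prod F (fun i => (X i : MvPolynomial V k)) (fun _ => 1)
    fun i _ => isHomogeneous_X k i
  simpa using this

variable [Fintype V]

/-- The class of a monomial in `A(Δ)` is either zero or a multiple of a squarefree monomial. -/
theorem mk_monomial_eq (s : V →₀ ℕ) (c : k) :
    Ideal.Quotient.mkₐ k (Δ.sqIdeal k) (monomial s c) = 0 ∨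
      Ideal.Quotient.mkₐ k (Δ.sqIdeal k) (monomial s c) = c • Δ.faceMonomial k s.support := by
  classical
  by_cases h : ∃ v, 2 ≤ s v
  · obtain ⟨v, hv⟩ := h
    refine Or.inl (mk_eq_zero_of_sq_dvd (v := v) ?_)
    rw [X_pow_eq_monomial, monomial_dvd_monomial]
    refine ⟨Or.inr fun w => ?_, one_dvd _⟩
    rw [Finsupp.single_apply]
    split_ifs with h
    · exact h ▸ hv
    · exact Nat.zero_le _
  · push Not at h
    have hs : s = ∑ i ∈ s.support, Finsupp.single i 1 := by
      ext v
      rw [sum_single_apply]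
      have := h v
      by_cases hv : s v = 0
      · simp [hv]
      · rw [if_pos (Finsupp.mem_support_iff.2 hv)]
        omega
    refine Or.inr ?_
    rw [faceMonomial, prod_X_eq_monomial, ← hs, ← map_smul, smul_monomial, smul_eq_mul, mul_one]

variable (Δ k) in
theorem span_faceMonomial :
    Submodule.span k (Set.range (Δ.faceMonomial k)) = ⊤ := by
  refine eq_top_iff.2 fun a _ => ?_
  obtain ⟨p, rfl⟩ := Ideal.Quotient.mkₐ_surjective k (Δ.sqIdeal k) a
  induction p using MvPolynomial.induction_on' with
  | monomial s c =>
    rcases mk_monomial_eq (Δ := Δ) s c with h | h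
    · rw [h]
      exact zero_mem _
    · rw [h]
      exact Submodule.smul_mem _ _ (Submodule.subset_span ⟨_, rfl⟩)
  | add p q hp hq =>
    rw [map_add]
    exact add_mem (hp trivial) (hq trivial)

instance finite_A : Module.Finite k (Δ.A k) :=
  Module.Finite.of_fg_top ((Δ.span_faceMonomial k) ▸ Submodule.fg_span (Set.finite_range _))

/-- The expansion of an element of `A(Δ)` in squarefree monomials. -/
theorem sum_faceCoeff_smul (a : Δ.A k) :
    ∑ F, Δ.faceCoeff k F a • Δ.faceMonomial k F = a := by
  classical
  have h : (∑ F, (Δ.faceCoeff k F).smulRight (Δ.faceMonomial k F)) = LinearMap.id := by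
    refine LinearMap.ext_on (Δ.span_faceMonomial k) ?_
    rintro _ ⟨G, rfl⟩
    by_cases hG : G ∈ Δ.faces
    · rw [LinearMap.sum_apply, Finset.sum_eq_single G]
      · simp [faceCoeff_faceMonomial hG]
      · intro F _ hFG
        by_cases hF : F ∈ Δ.faces
        · simp [faceCoeff_faceMonomial hF, hFG]
        · simp [faceMonomial_of_notMem hF]
      · simp
    · simp [faceMonomial_of_notMem hG]
  simpa using LinearMap.congr_fun h a

theorem eq_of_faceCoeff_eq {a b : Δ.A k} (h : ∀ F ∈ Δ.faces, Δ.faceCoeff k F a = Δ.faceCoeff k F b) :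
    a = b := by
  rw [← sum_faceCoeff_smul a, ← sum_faceCoeff_smul b]
  refine Finset.sum_congr rfl fun F _ => ?_
  by_cases hF : F ∈ Δ.faces
  · rw [h F hF]
  · simp [faceMonomial_of_notMem hF]

/-- The only basis monomial that `x_G` can send to `x_F` is `x_{F \ G}`. This transpose of
multiplication drives all computations in `ω_R`. -/
theorem faceCoeff_faceMonomial_mul [DecidableEq V] {F : Finset V} (hF : F ∈ Δ.faces) (G : Finset V)
    (a : Δ.A k) : Δ.faceCoeff k F (Δ.faceMonomial k G * a) =
      if G ⊆ F then Δ.faceCoeff k (F \ G) a else 0 := by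
  have h : Δ.faceCoeff k F ∘ₗ LinearMap.mulLeft k (Δ.faceMonomial k G) =
      if G ⊆ F then Δ.faceCoeff k (F \ G) else 0 := by
    refine LinearMap.ext_on (Δ.span_faceMonomial k) ?_
    rintro _ ⟨H, rfl⟩
    rw [LinearMap.comp_apply, LinearMap.mulLeft_apply]
    by_cases hGH : Disjoint G H
    · rw [faceMonomial_mul_of_disjoint hGH, faceCoeff_faceMonomial hF]
      split_ifs with h1 h2 h2
      · rw [faceCoeff_faceMonomial (Δ.down_closed hF Finset.sdiff_subset), if_pos]
        rw [h1, Finset.union_sdiff_left, hGH.symm.sdiff_eq_left]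
      · exact absurd (h1 ▸ Finset.subset_union_left) h2
      · rw [faceCoeff_faceMonomial (Δ.down_closed hF Finset.sdiff_subset), if_neg]
        rintro rfl
        exact h1 (Finset.union_sdiff_of_subset h2).symm
      · rfl
    · rw [faceMonomial_mul_of_not_disjoint hGH, map_zero]
      split_ifs
      · rw [faceCoeff_faceMonomial (Δ.down_closed hF Finset.sdiff_subset), if_neg]
        rintro rfl
        exact hGH Finset.disjoint_sdiff
      · rfl
  have := LinearMap.congr_fun h a
  rw [LinearMap.comp_apply, LinearMap.mulLeft_apply] at this
  rw [this]
  split_ifs <;> rfl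

/-- The degree `i` part of `A(Δ)` is spanned by the monomials of the faces with `i` vertices. -/
theorem mem_gradingA_iff {i : ℕ} {a : Δ.A k} :
    a ∈ Δ.gradingA k i ↔ ∀ F ∈ Δ.faces, F.card ≠ i → Δ.faceCoeff k F a = 0 := by
  classical
  constructor
  · rintro ⟨p, hp, rfl⟩ F hF hi
    refine (faceCoeff_mk hF p).trans ?_
    by_contra h
    refine hi ?_
    have := hp h
    rw [← this, Finsupp.weight_apply, Finsupp.sum_fintype _ _ (by simp)]
    simp only [sum_single_apply]
    simp
  · intro h
    rw [← sum_faceCoeff_smul a]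
    refine sum_mem fun F _ => ?_
    by_cases hF : F ∈ Δ.faces
    · by_cases hi : F.card = i
      · exact Submodule.smul_mem _ _ (hi ▸ faceMonomial_mem_gradingA F)
      · rw [h F hF hi, zero_smul]
        exact zero_mem _
    · rw [faceCoeff_of_notMem hF, zero_smul]
      exact zero_mem _

instance gradedMonoid_gradingA : SetLike.GradedMonoid (Δ.gradingA k) where
  one_mem := by
    rw [← faceMonomial_empty]
    exact faceMonomial_mem_gradingA ∅
  mul_mem i j := by
    rintro _ _ ⟨p, hp, rfl⟩ ⟨q, hq, rfl⟩
    exact ⟨p * q, IsHomogeneous.mul hp hq, map_mul (Ideal.Quotient.mkₐ k (Δ.sqIdeal k)) p q⟩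

end SimplicialCx

/-! ### Gradings from coordinates -/

/-- A family of subspaces cut out by the coordinates of a homogeneous generating family, whose
coordinate functionals are given, is a direct sum decomposition. -/
theorem isInternal_of_homogeneous_coordinates {k M ι : Type*} [Field k] [AddCommGroup M]
    [Module k M] [Fintype ι] (𝒜 : ℕ → Submodule k M) (b : ι → M) (c : ι → M →ₗ[k] k) (deg : ι → ℕ)
    (hb : ∀ m, ∑ j, c j m • b j = m) (hmem : ∀ j, b j ∈ 𝒜 (deg j))
    (hc : ∀ i, ∀ m ∈ 𝒜 i, ∀ j, deg j ≠ i → c j m = 0) : DirectSum.IsInternal 𝒜 := by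
  -- The coordinate `c j` of a sum sees only the component of degree `deg j`.
  have key : ∀ (f : DirectSum ℕ fun i => 𝒜 i) j,
      c j (DirectSum.coeAddMonoidHom 𝒜 f) = c j (f (deg j)) := by
    intro f j
    induction f using DirectSum.induction_on with
    | zero => simp
    | of i x =>
      rw [DirectSum.coeAddMonoidHom_of]
      by_cases h : deg j = i
      · subst h
        rw [DirectSum.of_eq_same]
      · rw [DirectSum.of_eq_of_ne _ _ _ h, hc i x x.2 j h]
        simp
    | add f g hf hg => rw [map_add, map_add, hf, hg, DirectSum.add_apply]; simp
  constructor
  · refine (injective_iff_map_eq_zero _).2 fun f hf => ?_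
    ext i
    rw [← hb (f i)]
    refine Finset.sum_eq_zero fun j _ => ?_
    by_cases h : deg j = i
    · rw [← h, ← key, hf, map_zero, zero_smul]
    · rw [hc i _ (f i).2 j h, zero_smul]
  · intro m
    refine ⟨∑ j, DirectSum.of (fun i => 𝒜 i) (deg j) (c j m • ⟨b j, hmem j⟩), ?_⟩
    rw [map_sum]
    conv_rhs => rw [← hb m]
    exact Finset.sum_congr rfl fun j _ => DirectSum.coeAddMonoidHom_of _ _ _

theorem isArtinianRing_of_moduleFinite (k B : Type*) [Field k] [CommRing B] [Algebra k B]
    [Module.Finite k B] : IsArtinianRing B :=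
  IsArtinianRing.of_finite k B

/-! ### Products and degrees in the idealization -/

section Idealization

variable {k R : Type*} [Field k] [CommRing R] [Algebra k R]

theorem mem_idealizationGrading {ℛ : ℕ → Submodule k R} {a : ℤ} {i : ℕ} {x : Idealization k R} :
    x ∈ idealizationGrading ℛ a i ↔
      x.fst ∈ ℛ i ∧ x.snd ∈ CanonicalModule.grading ℛ (a + i) := Iff.rfl

theorem CanonicalModule.smul_mem_grading {ℛ : ℕ → Submodule k R} [SetLike.GradedMonoid ℛ]
    {i : ℕ} {n m : ℤ} (hm : m = i + n) {r : R} (hr : r ∈ ℛ i) {φ : CanonicalModule k R}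
    (hφ : φ ∈ CanonicalModule.grading ℛ n) : r • φ ∈ CanonicalModule.grading ℛ m := by
  intro j hj t ht
  rw [CanonicalModule.ring_smul_apply]
  refine hφ (i + j) ?_ _ (SetLike.mul_mem_graded hr ht)
  push_cast
  omega

theorem gradedMonoid_idealizationGrading (ℛ : ℕ → Submodule k R) [SetLike.GradedMonoid ℛ] (a : ℤ) :
    SetLike.GradedMonoid (idealizationGrading ℛ a) where
  one_mem := ⟨SetLike.one_mem_graded ℛ, zero_mem _⟩
  mul_mem i j x y hx hy := by
    refine ⟨SetLike.mul_mem_graded hx.1 hy.1, ?_⟩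
    rw [TrivSqZeroExt.snd_mul, op_smul_eq_smul]
    refine add_mem (CanonicalModule.smul_mem_grading ?_ hx.1 hy.2)
      (CanonicalModule.smul_mem_grading ?_ hy.1 hx.2) <;> push_cast <;> ring

/-- As `ω_R` squares to zero, the canonical part of `x` plays no role. -/
theorem mul_inr_eq (x : Idealization k R) (φ : CanonicalModule k R) :
    x * TrivSqZeroExt.inr φ = TrivSqZeroExt.inr (x.fst • φ) := by
  ext1
  · simp
  · simp

theorem inl_mul_snd (r : R) (x : Idealization k R) :
    (TrivSqZeroExt.inl r * x).snd = r • x.snd := by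
  simp

end Idealization

/-! ### The Gorenstein property for pure complexes -/

namespace SimplicialCx

open TrivSqZeroExt

variable {V : Type*} {Δ : SimplicialCx V} {k : Type*} [Field k] {d : ℕ}

theorem empty_mem_faces (Δ : SimplicialCx V) : ∅ ∈ Δ.faces :=
  let ⟨_, hF⟩ := Δ.nonempty
  Δ.down_closed hF (Finset.empty_subset _)

variable (Δ k) in
/-- The functional dual to the monomial `x_F`, as an element of the canonical module. -/
noncomputable def faceDual (F : Finset V) : CanonicalModule k (Δ.A k) := Δ.faceCoeff k F

theorem faceDual_apply (F : Finset V) (a : Δ.A k) : Δ.faceDual k F a = Δ.faceCoeff k F a := rfl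

theorem faceDual_of_notMem {F : Finset V} (hF : F ∉ Δ.faces) : Δ.faceDual k F = 0 :=
  CanonicalModule.ext_iff'.2 fun a => faceCoeff_of_notMem hF a

theorem canonical_sum_apply {ι : Type*} (s : Finset ι) (f : ι → CanonicalModule k (Δ.A k))
    (a : Δ.A k) : (∑ i ∈ s, f i) a = ∑ i ∈ s, f i a :=
  LinearMap.sum_apply s (fun i => (f i : Module.Dual k (Δ.A k))) a

theorem inl_faceMonomial_singleton_mem (a : ℤ) (v : V) :
    (inl (Δ.faceMonomial k {v}) : Idealization k (Δ.A k)) ∈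
      idealizationGrading (Δ.gradingA k) a 1 :=
  ⟨faceMonomial_mem_gradingA {v}, zero_mem _⟩

theorem inr_faceDual_empty_ne_zero :
    (inr (Δ.faceDual k ∅) : Idealization k (Δ.A k)) ≠ 0 := by
  classical
  intro h
  have h' := CanonicalModule.ext_iff'.1 (congrArg snd h) (Δ.faceMonomial k ∅)
  rw [snd_inr, faceDual_apply, faceCoeff_faceMonomial Δ.empty_mem_faces, if_pos rfl] at h'
  exact one_ne_zero h'

variable [Fintype V]

theorem exists_isFacet_superset {F : Finset V} (hF : F ∈ Δ.faces) : ∃ G, Δ.IsFacet G ∧ F ⊆ G :=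
  let ⟨G, hFG, hG⟩ := (Set.toFinite Δ.faces).exists_le_maximal hF
  ⟨G, hG, hFG⟩

theorem card_le_of_mem_faces (hpure : ∀ F, Δ.IsFacet F → F.card = d) {F : Finset V}
    (hF : F ∈ Δ.faces) : F.card ≤ d :=
  let ⟨G, hG, hFG⟩ := exists_isFacet_superset hF
  hpure G hG ▸ Finset.card_le_card hFG

theorem isFacet_of_card_eq (hpure : ∀ F, Δ.IsFacet F → F.card = d) {F : Finset V}
    (hF : F ∈ Δ.faces) (hd : F.card = d) : Δ.IsFacet F := by
  obtain ⟨G, hG, hFG⟩ := exists_isFacet_superset hF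
  rwa [Finset.eq_of_subset_of_card_le hFG (by rw [hpure G hG, hd])]

theorem canonical_apply_eq_sum (φ : CanonicalModule k (Δ.A k)) (a : Δ.A k) :
    φ a = ∑ F, Δ.faceCoeff k F a * φ (Δ.faceMonomial k F) := by
  conv_lhs => rw [← sum_faceCoeff_smul a]
  exact (map_sum (show Module.Dual k (Δ.A k) from φ) _ _).trans
    (Finset.sum_congr rfl fun F _ => CanonicalModule.apply_smul φ _ _)

theorem canonical_eq_of_apply_eq {φ ψ : CanonicalModule k (Δ.A k)}
    (h : ∀ F ∈ Δ.faces, φ (Δ.faceMonomial k F) = ψ (Δ.faceMonomial k F)) : φ = ψ := by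
  refine CanonicalModule.ext_iff'.2 fun a => ?_
  rw [canonical_apply_eq_sum, canonical_apply_eq_sum ψ]
  refine Finset.sum_congr rfl fun F _ => ?_
  by_cases hF : F ∈ Δ.faces
  · rw [h F hF]
  · rw [faceCoeff_of_notMem hF, zero_mul, zero_mul]

theorem mem_canonicalGrading_iff {n : ℤ} {φ : CanonicalModule k (Δ.A k)} :
    φ ∈ CanonicalModule.grading (Δ.gradingA k) n ↔
      ∀ F ∈ Δ.faces, (F.card : ℤ) ≠ -n → φ (Δ.faceMonomial k F) = 0 := by
  constructor
  · intro h F _ hn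
    exact h _ hn _ (faceMonomial_mem_gradingA F)
  · intro h j hj a ha
    rw [canonical_apply_eq_sum]
    refine Finset.sum_eq_zero fun F _ => ?_
    by_cases hF : F ∈ Δ.faces
    · by_cases hFj : F.card = j
      · rw [h F hF (hFj ▸ hj), mul_zero]
      · rw [mem_gradingA_iff.1 ha F hF hFj, zero_mul]
    · rw [faceCoeff_of_notMem hF, zero_mul]

variable [DecidableEq V]

theorem sum_smul_faceDual_apply (c : Finset V → k) {F : Finset V} (hF : F ∈ Δ.faces) :
    (∑ G, c G • Δ.faceDual k G) (Δ.faceMonomial k F) = c F := by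
  rw [canonical_sum_apply, Finset.sum_eq_single F]
  · rw [CanonicalModule.smul_apply, faceDual_apply, faceCoeff_faceMonomial hF, if_pos rfl, mul_one]
  · intro G _ hGF
    rw [CanonicalModule.smul_apply, faceDual_apply]
    by_cases hG : G ∈ Δ.faces
    · rw [faceCoeff_faceMonomial hG, if_neg hGF, mul_zero]
    · rw [faceCoeff_of_notMem hG, mul_zero]
  · simp

theorem sum_apply_smul_faceDual (φ : CanonicalModule k (Δ.A k)) :
    ∑ F, φ (Δ.faceMonomial k F) • Δ.faceDual k F = φ :=
  canonical_eq_of_apply_eq fun _ hF => sum_smul_faceDual_apply _ hF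

theorem faceDual_mem_grading {F : Finset V} {n : ℤ} (hn : (F.card : ℤ) = -n) :
    Δ.faceDual k F ∈ CanonicalModule.grading (Δ.gradingA k) n := by
  by_cases hF : F ∈ Δ.faces
  · refine mem_canonicalGrading_iff.2 fun G _ hG => ?_
    rw [faceDual_apply, faceCoeff_faceMonomial hF, if_neg]
    rintro rfl
    exact hG hn
  · rw [faceDual_of_notMem hF]
    exact zero_mem _

/-- Levelness: with `G` a facet, this shows that the duals of facets generate `ω_R`. -/
theorem faceMonomial_smul_faceDual {F G : Finset V} (hG : G ∈ Δ.faces) (hFG : F ⊆ G) :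
    Δ.faceMonomial k (G \ F) • Δ.faceDual k G = Δ.faceDual k F := by
  refine CanonicalModule.ext_iff'.2 fun a => ?_
  rw [CanonicalModule.ring_smul_apply, faceDual_apply, faceDual_apply,
    faceCoeff_faceMonomial_mul hG, if_pos Finset.sdiff_subset, Finset.sdiff_sdiff_eq_self hFG]

instance finite_canonicalModule : Module.Finite k (CanonicalModule k (Δ.A k)) :=
  inferInstanceAs (Module.Finite k (Module.Dual k (Δ.A k)))

instance finite_idealization : Module.Finite k (Idealization k (Δ.A k)) :=
  inferInstanceAs (Module.Finite k (Δ.A k × CanonicalModule k (Δ.A k)))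

theorem isInternal_idealizationGrading (hpure : ∀ F, Δ.IsFacet F → F.card = d) :
    DirectSum.IsInternal (idealizationGrading (Δ.gradingA k) (-(d : ℤ) - 1)) := by
  refine isInternal_of_homogeneous_coordinates (ι := Finset V ⊕ Finset V) _
    (Sum.elim (fun F => inl (Δ.faceMonomial k F)) fun F => inr (Δ.faceDual k F))
    (Sum.elim (fun F => Δ.faceCoeff k F ∘ₗ
        (LinearMap.fst k (Δ.A k) (CanonicalModule k (Δ.A k)) : _ →ₗ[k] _))
      fun F => { toFun := fun x => x.snd (Δ.faceMonomial k F)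
                 map_add' := fun _ _ => rfl
                 map_smul' := fun _ _ => rfl })
    -- `F*` has degree `-|F|` in `ω_R`, hence `d + 1 - |F|` after the shift. The subtraction does
    -- not truncate on faces, where `|F| ≤ d`; for a non-face the dual is zero and its degree is
    -- irrelevant.
    (Sum.elim (fun F => F.card) fun F => d + 1 - F.card) ?_ ?_ ?_
  · intro x
    rw [Fintype.sum_sum_type]
    refine TrivSqZeroExt.ext ?_ ?_
    · refine Eq.trans ?_ (sum_faceCoeff_smul x.fst)
      rw [fst_add, fst_sum, fst_sum]
      simp
      rfl
    · refine Eq.trans ?_ (sum_apply_smul_faceDual x.snd)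
      rw [snd_add, snd_sum, snd_sum]
      simp
      rfl
  · rintro (F | F)
    · exact ⟨faceMonomial_mem_gradingA F, zero_mem _⟩
    · refine ⟨zero_mem _, ?_⟩
      by_cases hF : F ∈ Δ.faces
      · refine faceDual_mem_grading ?_
        have := card_le_of_mem_faces hpure hF
        simp only [Sum.elim_inr]
        omega
      · change Δ.faceDual k F ∈ _
        rw [faceDual_of_notMem hF]
        exact zero_mem _
  · rintro i x ⟨hx₁, hx₂⟩ (F | F) hi
    · by_cases hF : F ∈ Δ.faces
      · exact mem_gradingA_iff.1 hx₁ F hF hi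
      · exact faceCoeff_of_notMem hF _
    · by_cases hF : F ∈ Δ.faces
      · refine mem_canonicalGrading_iff.1 hx₂ F hF ?_
        have := card_le_of_mem_faces hpure hF
        simp only [Sum.elim_inr] at hi
        omega
      · change x.snd (Δ.faceMonomial k F) = 0
        rw [faceMonomial_of_notMem hF]
        exact CanonicalModule.apply_zero _

theorem gradingA_zero : Δ.gradingA k 0 = 1 := by
  refine le_antisymm (fun a ha => ?_) ?_
  · refine Submodule.mem_one.2 ⟨Δ.faceCoeff k ∅ a, ?_⟩
    rw [Algebra.algebraMap_eq_smul_one, ← faceMonomial_empty]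
    refine eq_of_faceCoeff_eq fun F hF => ?_
    rw [map_smul, faceCoeff_faceMonomial hF]
    split_ifs with h
    · rw [h, smul_eq_mul, mul_one]
    · rw [smul_zero, mem_gradingA_iff.1 ha F hF (by simpa using h)]
  · rw [Submodule.one_le]
    exact SetLike.one_mem_graded _

theorem idealizationGrading_zero (hpure : ∀ F, Δ.IsFacet F → F.card = d) :
    idealizationGrading (Δ.gradingA k) (-(d : ℤ) - 1) 0 = 1 := by
  refine le_antisymm ?_ ?_
  · rintro x ⟨hx₁, hx₂⟩
    rw [gradingA_zero] at hx₁
    obtain ⟨c, hc⟩ := Submodule.mem_one.1 hx₁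
    refine Submodule.mem_one.2 ⟨c, TrivSqZeroExt.ext hc ?_⟩
    -- The canonical part of degree 0 is dual to `R_{d+1}`, which is zero.
    refine (canonical_eq_of_apply_eq fun F hF => ?_).symm
    refine mem_canonicalGrading_iff.1 hx₂ F hF ?_
    have := card_le_of_mem_faces hpure hF
    push_cast
    omega
  · rw [Submodule.one_le]
    exact ⟨SetLike.one_mem_graded _, zero_mem _⟩

theorem inr_faceDual_mem {F : Finset V} (hF : F.card = d) :
    (inr (Δ.faceDual k F) : Idealization k (Δ.A k)) ∈
      idealizationGrading (Δ.gradingA k) (-(d : ℤ) - 1) 1 :=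
  ⟨zero_mem _, faceDual_mem_grading (by push_cast; omega)⟩

theorem adjoin_idealizationGrading_one (hpure : ∀ F, Δ.IsFacet F → F.card = d) :
    Algebra.adjoin k (idealizationGrading (Δ.gradingA k) (-(d : ℤ) - 1) 1 :
      Set (Idealization k (Δ.A k))) = ⊤ := by
  set S := Algebra.adjoin k (idealizationGrading (Δ.gradingA k) (-(d : ℤ) - 1) 1 :
      Set (Idealization k (Δ.A k)))
  have hmon : ∀ F, (inl (Δ.faceMonomial k F) : Idealization k (Δ.A k)) ∈ S := by
    intro F
    induction F using Finset.induction_on with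
    | empty =>
      rw [faceMonomial_empty]
      exact one_mem S
    | insert v F hv ih =>
      rw [Finset.insert_eq, ← faceMonomial_mul_of_disjoint (Finset.disjoint_singleton_left.2 hv),
        inl_mul]
      exact mul_mem (Algebra.subset_adjoin (inl_faceMonomial_singleton_mem _ v)) ih
  have hdual : ∀ F, (inr (Δ.faceDual k F) : Idealization k (Δ.A k)) ∈ S := by
    intro F
    by_cases hF : F ∈ Δ.faces
    · obtain ⟨G, hG, hFG⟩ := exists_isFacet_superset hF
      rw [← faceMonomial_smul_faceDual hG.1 hFG, ← inl_mul_inr]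
      exact mul_mem (hmon _) (Algebra.subset_adjoin (inr_faceDual_mem (hpure G hG)))
    · rw [faceDual_of_notMem hF, inr_zero]
      exact zero_mem S
  refine eq_top_iff.2 fun x _ => ?_
  rw [← inl_fst_add_inr_snd_eq x]
  refine add_mem ?_ ?_
  · rw [← sum_faceCoeff_smul x.fst, inl_sum]
    refine sum_mem fun F _ => ?_
    rw [inl_smul]
    exact S.smul_mem (hmon F) _
  · rw [← sum_apply_smul_faceDual x.snd, inr_sum]
    refine sum_mem fun F _ => ?_
    rw [inr_smul]
    exact S.smul_mem (hdual F) _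

/-- Degree 1 already cuts the socle down: the duals of facets kill the `R` part, and the variables
leave only functionals determined by their value at 1. -/
theorem gradedSocle_idealizationGrading (hpure : ∀ F, Δ.IsFacet F → F.card = d) :
    gradedSocle (idealizationGrading (Δ.gradingA k) (-(d : ℤ) - 1)) =
      Submodule.span k {inr (Δ.faceDual k ∅)} := by
  refine le_antisymm ?_ ?_
  · intro x hx
    have hfst : x.fst = 0 := by
      refine eq_of_faceCoeff_eq fun F hF => ?_
      -- For a facet `G ⊇ F`, the value of `x.fst • G*` at `x_{G \ F}` is the coefficient of `x_F`
      -- in `x.fst`.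
      obtain ⟨G, hG, hFG⟩ := exists_isFacet_superset hF
      have h := congrArg snd (hx 1 le_rfl _ (inr_faceDual_mem (k := k) (Δ := Δ) (hpure G hG)))
      rw [mul_comm, mul_inr_eq, snd_inr] at h
      have h' := CanonicalModule.ext_iff'.1 h (Δ.faceMonomial k (G \ F))
      rw [CanonicalModule.ring_smul_apply, faceDual_apply, mul_comm,
        faceCoeff_faceMonomial_mul hG.1, if_pos Finset.sdiff_subset,
        Finset.sdiff_sdiff_eq_self hFG] at h'
      rw [h', map_zero]
      rfl
    refine Submodule.mem_span_singleton.2 ⟨x.snd 1, TrivSqZeroExt.ext ?_ ?_⟩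
    · rw [hfst, fst_smul, fst_inr, smul_zero]
    · rw [snd_smul, snd_inr]
      refine canonical_eq_of_apply_eq fun F hF => ?_
      rw [CanonicalModule.smul_apply, faceDual_apply, faceCoeff_faceMonomial Δ.empty_mem_faces]
      split_ifs with h
      · rw [← h, faceMonomial_empty, mul_one]
      -- For `v ∈ F`, the value of `x.snd` at `x_F` is that of `x_v • x.snd = 0` at `x_{F \ v}`.
      · obtain ⟨v, hv⟩ := Finset.nonempty_iff_ne_empty.2 (Ne.symm h)
        have h := congrArg snd (hx 1 le_rfl _ (inl_faceMonomial_singleton_mem _ v))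
        rw [inl_mul_snd] at h
        have h' := CanonicalModule.ext_iff'.1 h (Δ.faceMonomial k (F \ {v}))
        rw [CanonicalModule.ring_smul_apply,
          faceMonomial_mul_of_disjoint Finset.disjoint_sdiff,
          Finset.union_sdiff_of_subset (Finset.singleton_subset_iff.2 hv)] at h'
        rw [mul_zero, h']
        rfl
  · rw [Submodule.span_singleton_le_iff_mem]
    intro n hn a ha
    rw [mul_inr_eq, ← inr_zero]
    refine congrArg inr (canonical_eq_of_apply_eq fun F _ => ?_)
    rw [CanonicalModule.ring_smul_apply, faceDual_apply, mul_comm,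
      faceCoeff_faceMonomial_mul Δ.empty_mem_faces, Finset.empty_sdiff,
      mem_gradingA_iff.1 ha.1 ∅ Δ.empty_mem_faces (by rw [Finset.card_empty]; omega), ite_self]
    rfl

/-- For a pure complex, `A(Δ)` is level, so its idealization with the shifted canonical module is
a standard graded Artinian Gorenstein algebra. -/
theorem isArtinianGorenstein_idealization (hpure : ∀ F, Δ.IsFacet F → F.card = d) :
    IsArtinianGorenstein (idealizationGrading (Δ.gradingA k) (-(d : ℤ) - 1)) where
  standardGraded :=
    { gradedMonoid := gradedMonoid_idealizationGrading _ _
      isInternal := isInternal_idealizationGrading hpure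
      degree_zero := idealizationGrading_zero hpure
      finite_one := inferInstance
      adjoin_one := adjoin_idealizationGrading_one hpure }
  artinian := isArtinianRing_of_moduleFinite k _
  socle := by
    rw [gradedSocle_idealizationGrading hpure]
    exact finrank_span_singleton inr_faceDual_empty_ne_zero

end SimplicialCx

/-! ### Facet signs, facet weights and the failure of the weak Lefschetz property -/

namespace SimplicialCx

open TrivSqZeroExt

variable {V : Type*} [Fintype V] [DecidableEq V] {Δ : SimplicialCx V} {k : Type*} [Field k] {e : ℕ}

/-- If the dual graph of a pseudomanifold without boundary is bipartite, then the facets carry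
signs such that every ridge lies in exactly two facets, and these have opposite signs. -/
theorem exists_facet_sign (k : Type*) [Field k] (hΔ : Δ.IsPseudomanifoldWithoutBoundary e)
    (hbip : (Δ.dualGraph e).IsBipartite) :
    ∃ ε : Finset V → k, (∀ F, Δ.IsFacet F → ε F ≠ 0) ∧
      ∀ E, Δ.IsFaceOfCard e E → ∃ v w, v ≠ w ∧ v ∉ E ∧ w ∉ E ∧
        Δ.IsFacet (insert v E) ∧ Δ.IsFacet (insert w E) ∧
        ε (insert v E) + ε (insert w E) = 0 ∧
        ∀ u ∉ E, Δ.IsFacet (insert u E) → u = v ∨ u = w := by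
  classical
  obtain ⟨col⟩ := hbip
  refine ⟨fun F => if h : Δ.IsFacet F then if col ⟨F, h⟩ = 0 then 1 else -1 else 0, ?_, ?_⟩
  · intro F hF
    dsimp only
    rw [dif_pos hF]
    split_ifs <;> simp
  intro E hE
  have hins : ∀ F, Δ.IsFacet F → E ⊆ F → ∃ v ∉ E, insert v E = F := by
    intro F hF hEF
    have hc : (F \ E).card = 1 := by
      rw [Finset.card_sdiff_of_subset hEF, hΔ.pure F hF, hE.2]
      omega
    obtain ⟨v, hv⟩ := Finset.card_eq_one.1 hc
    refine ⟨v, fun h => ?_, ?_⟩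
    · have : v ∈ F \ E := hv ▸ Finset.mem_singleton_self v
      exact (Finset.mem_sdiff.1 this).2 h
    · rw [Finset.insert_eq, ← hv, Finset.sdiff_union_of_subset hEF]
  have hadj : ∀ F G (hF : Δ.IsFacet F) (hG : Δ.IsFacet G), F ≠ G → E ⊆ F → E ⊆ G →
      col ⟨F, hF⟩ ≠ col ⟨G, hG⟩ := fun F G hF hG hne hEF hEG =>
    col.valid ⟨fun h => hne (congrArg Subtype.val h), E, hE, hEF, hEG⟩
  obtain ⟨F, hF, hEF⟩ := exists_isFacet_superset hE.1
  -- A ridge in a single facet would be a boundary ridge.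
  obtain ⟨G, hG, hEG, hne⟩ : ∃ G, Δ.IsFacet G ∧ E ⊆ G ∧ G ≠ F := by
    by_contra! h
    refine hΔ.no_boundary F E ⟨hF.1, hΔ.pure F hF⟩ hEF ⟨hE, Set.ncard_eq_one.2 ⟨F, ?_⟩⟩
    ext G
    constructor
    · rintro ⟨hG, hEG⟩
      exact h G (isFacet_of_card_eq hΔ.pure hG.1 hG.2) hEG
    · rintro rfl
      exact ⟨⟨hF.1, hΔ.pure G hF⟩, hEF⟩
  obtain ⟨v, hv, rfl⟩ := hins F hF hEF
  obtain ⟨w, hw, rfl⟩ := hins G hG hEG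
  have hvw := hadj _ _ hF hG hne.symm hEF hEG
  refine ⟨v, w, fun h => hne (by rw [h]), hv, hw, hF, hG, ?_, ?_⟩
  · dsimp only
    rw [dif_pos hF, dif_pos hG]
    split_ifs with h1 h2 h2
    · exact absurd (h1.trans h2.symm) hvw
    · ring
    · ring
    · omega
  · intro u hu hU
    have hsub : E ⊆ insert u E := Finset.subset_insert u E
    have hinj : ∀ t, insert u E = insert t E → u = t := fun t h =>
      (Finset.mem_insert.1 (h ▸ Finset.mem_insert_self u E)).resolve_right hu
    -- Three facets through one ridge are pairwise adjacent, which two colours forbid. This bound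
    -- needs no case distinction on `e`.
    by_contra! h
    have h1 := hadj _ _ hU hF (fun h' => h.1 (hinj v h')) hsub hEF
    have h2 := hadj _ _ hU hG (fun h' => h.2 (hinj w h')) hsub hEG
    omega

/-- Weights on the facets that are annihilated by the linear form with coefficients `α`. -/
theorem exists_facet_weight (hΔ : Δ.IsPseudomanifoldWithoutBoundary e)
    (hbip : (Δ.dualGraph e).IsBipartite) (α : V → k) :
    ∃ c : Finset V → k, (∃ F, Δ.IsFacet F ∧ c F ≠ 0) ∧ (∀ F, ¬ Δ.IsFacet F → c F = 0) ∧
      ∀ E, ∑ v with v ∉ E, α v * c (insert v E) = 0 := by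
  classical
  obtain ⟨ε, hε, hridge⟩ := exists_facet_sign k hΔ hbip
  let zeros : Finset V → Finset V := fun F => F.filter fun v => α v = 0
  let P : Finset V → k := fun F => ∏ v ∈ F, if α v = 0 then 1 else α v
  have hP : ∀ F, P F ≠ 0 := fun F => Finset.prod_ne_zero_iff.2 fun v _ => by
    split_ifs with h
    exacts [one_ne_zero, h]
  obtain ⟨F₀, hF₀, hmax⟩ : ∃ F₀, Δ.IsFacet F₀ ∧
      ∀ F, Δ.IsFacet F → (zeros F).card ≤ (zeros F₀).card := by
    obtain ⟨F₁, hF₁, -⟩ := exists_isFacet_superset Δ.empty_mem_faces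
    obtain ⟨F₀, h, h'⟩ := (Finset.univ.filter Δ.IsFacet).exists_max_image
      (fun F => (zeros F).card) ⟨F₁, by simpa using hF₁⟩
    exact ⟨F₀, by simpa using h, fun F hF => h' F (by simpa using hF)⟩
  -- Maximality of `zeros F₀` is what makes the relation hold at ridges where one of the two
  -- coefficients vanishes.
  let c : Finset V → k := fun F => if Δ.IsFacet F ∧ zeros F = zeros F₀ then ε F * (P F)⁻¹ else 0
  have hc : ∀ F, ¬ Δ.IsFacet F → c F = 0 := fun F hF => if_neg fun h => hF h.1
  refine ⟨c, ⟨F₀, hF₀, ?_⟩, hc, fun E => ?_⟩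
  · simp only [c, hF₀, true_and, if_true]
    exact mul_ne_zero (hε F₀ hF₀) (inv_ne_zero (hP F₀))
  by_cases hE : Δ.IsFaceOfCard e E
  swap
  · refine Finset.sum_eq_zero fun v hv => ?_
    rw [hc, mul_zero]
    intro h
    refine hE ⟨Δ.down_closed h.1 (Finset.subset_insert v E), ?_⟩
    have := hΔ.pure _ h
    rw [Finset.card_insert_of_notMem (Finset.mem_filter.1 hv).2] at this
    omega
  obtain ⟨v, w, hvw, hv, hw, hF, hG, hsum, honly⟩ := hridge E hE
  have hzero : ∀ u, α u ≠ 0 → zeros (insert u E) = zeros E := fun u hu => by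
    simp only [zeros]
    rw [Finset.filter_insert, if_neg hu]
  -- The factor `α u` cancels against `P (insert u E)`, so apart from the sign the term depends only
  -- on `E`.
  have hone : ∀ u, u ∉ E → α u ≠ 0 → Δ.IsFacet (insert u E) →
      α u * c (insert u E) = if zeros E = zeros F₀ then ε (insert u E) * (P E)⁻¹ else 0 := by
    intro u huE hu hU
    simp only [c, hU, true_and, hzero u hu]
    split_ifs
    · simp only [P]
      rw [Finset.prod_insert huE, if_neg hu]
      have := hP E
      simp only [P] at this
      field_simp
    · rw [mul_zero]
  -- Otherwise `insert u E` would have one more zero than `F₀`. Hence, when exactly one of `α v`, `α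
  -- w` is zero, the other term vanishes too.
  have hne : ∀ u, u ∉ E → α u = 0 → Δ.IsFacet (insert u E) → zeros E ≠ zeros F₀ := by
    intro u huE hu hU h
    have := hmax _ hU
    simp only [zeros] at this h
    rw [Finset.filter_insert, if_pos hu, Finset.card_insert_of_notMem
      fun h' => huE (Finset.mem_filter.1 h').1, h] at this
    omega
  rw [Finset.sum_eq_add v w hvw]
  · by_cases h1 : α v = 0 <;> by_cases h2 : α w = 0
    · rw [h1, h2, zero_mul, zero_mul, add_zero]
    · rw [h1, zero_mul, zero_add, hone w hw h2 hG, if_neg (hne v hv h1 hF)]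
    · rw [h2, zero_mul, add_zero, hone v hv h1 hF, if_neg (hne w hw h2 hG)]
    · rw [hone v hv h1 hF, hone w hw h2 hG]
      split_ifs
      · rw [← add_mul, hsum, zero_mul]
      · rw [add_zero]
  · rintro u hu ⟨huv, huw⟩
    rw [hc, mul_zero]
    intro hU
    rcases honly u (Finset.mem_filter.1 hu).2 hU with h | h
    exacts [huv h, huw h]
  · intro h
    exact absurd (Finset.mem_filter.2 ⟨Finset.mem_univ v, hv⟩) h
  · intro h
    exact absurd (Finset.mem_filter.2 ⟨Finset.mem_univ w, hw⟩) h

theorem sum_faceCoeff_singleton_smul {a : Δ.A k} (ha : a ∈ Δ.gradingA k 1) :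
    ∑ v, Δ.faceCoeff k {v} a • Δ.faceMonomial k {v} = a := by
  refine eq_of_faceCoeff_eq fun F hF => ?_
  simp only [map_sum, map_smul, faceCoeff_faceMonomial hF, smul_eq_mul, mul_ite, mul_one, mul_zero]
  by_cases h : F.card = 1
  · obtain ⟨w, rfl⟩ := Finset.card_eq_one.1 h
    simp
  · rw [mem_gradingA_iff.1 ha F hF h]
    refine Finset.sum_eq_zero fun v _ => if_neg ?_
    rintro rfl
    exact h (Finset.card_singleton v)

/-- Every linear form of `A(Δ)` annihilates a nonzero functional of top degree. -/
theorem exists_canonical_annihilated (hΔ : Δ.IsPseudomanifoldWithoutBoundary e)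
    (hbip : (Δ.dualGraph e).IsBipartite) {a : Δ.A k} (ha : a ∈ Δ.gradingA k 1) :
    ∃ φ ∈ CanonicalModule.grading (Δ.gradingA k) (-((e + 1 : ℕ) : ℤ)), a • φ = 0 ∧
      ∃ F, Δ.IsFacet F ∧ φ (Δ.faceMonomial k F) ≠ 0 := by
  obtain ⟨c, ⟨F, hF, hcF⟩, hc, hsum⟩ :=
    exists_facet_weight hΔ hbip fun v => Δ.faceCoeff k {v} a
  set φ : CanonicalModule k (Δ.A k) := ∑ G, c G • Δ.faceDual k G
  have happ : ∀ G, φ (Δ.faceMonomial k G) = c G := by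
    intro G
    by_cases hG : G ∈ Δ.faces
    · exact sum_smul_faceDual_apply c hG
    · rw [faceMonomial_of_notMem hG, CanonicalModule.apply_zero, hc G fun h => hG h.1]
  refine ⟨φ, mem_canonicalGrading_iff.2 fun G _ hcard => ?_, ?_, F, hF, by rwa [happ]⟩
  · rw [happ, hc]
    intro h
    rw [hΔ.pure G h, neg_neg] at hcard
    exact hcard rfl
  · refine canonical_eq_of_apply_eq fun E _ => ?_
    rw [CanonicalModule.ring_smul_apply, CanonicalModule.zero_apply, ← hsum E,
      Finset.sum_filter]
    conv_lhs => rw [← sum_faceCoeff_singleton_smul ha, Finset.sum_mul]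
    refine (map_sum (show Module.Dual k (Δ.A k) from φ) _ _).trans (Finset.sum_congr rfl fun v _ => ?_)
    rw [smul_mul_assoc]
    refine (CanonicalModule.apply_smul φ _ _).trans ?_
    by_cases h : v ∈ E
    · rw [if_neg (not_not.2 h),
        faceMonomial_mul_of_not_disjoint fun h' => Finset.disjoint_singleton_left.1 h' h,
        CanonicalModule.apply_zero, mul_zero]
    · rw [if_pos h, faceMonomial_mul_of_disjoint (Finset.disjoint_singleton_left.2 h),
        ← Finset.insert_eq, happ]

/-- One annihilated top functional `φ` obstructs injectivity through the summand `ω_R` and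
surjectivity through the summand `R`. -/
theorem not_hasWLPInDegree_idealization (he : 1 ≤ e) (hΔ : Δ.IsPseudomanifoldWithoutBoundary e)
    (hbip : (Δ.dualGraph e).IsBipartite) :
    ¬ HasWLPInDegree (idealizationGrading (Δ.gradingA k) (-((e + 1 : ℕ) : ℤ) - 1)) e := by
  rintro ⟨l, hl, hinj | hsurj⟩ <;>
    obtain ⟨φ, hφ, haφ, F, hF, hφF⟩ := exists_canonical_annihilated hΔ hbip hl.1
  -- In the idealization `φ` has degree 1, so a monomial of degree `e - 1` is needed to reach degree
  -- `e`: two of the `e + 1` vertices of `F` are left out. The product is nonzero because its value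
  -- at `x_T` is `φ(x_F)`.
  · obtain ⟨T, hTF, hT⟩ := Finset.exists_subset_card_eq (s := F) (n := 2)
      (by rw [hΔ.pure F hF]; omega)
    have hdeg : -((e + 1 : ℕ) : ℤ) - 1 + e = ((F \ T).card : ℤ) + -((e + 1 : ℕ) : ℤ) := by
      rw [Finset.card_sdiff_of_subset hTF, hΔ.pure F hF, hT]
      omega
    have hmem : (inr (Δ.faceMonomial k (F \ T) • φ) : Idealization k (Δ.A k)) ∈
        idealizationGrading (Δ.gradingA k) (-((e + 1 : ℕ) : ℤ) - 1) e := by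
      refine mem_idealizationGrading.2 ⟨zero_mem _, ?_⟩
      rw [snd_inr]
      have hr : Δ.faceMonomial k (F \ T) ∈ Δ.gradingA k (F \ T).card :=
        faceMonomial_mem_gradingA (F \ T)
      exact CanonicalModule.smul_mem_grading (ℛ := Δ.gradingA k) hdeg hr hφ
    have h := congrArg snd <| hinj _ hmem <| by
      rw [mul_inr_eq, smul_comm, haφ, smul_zero, inr_zero]
    have h' := CanonicalModule.ext_iff'.1 h (Δ.faceMonomial k T)
    rw [snd_inr, CanonicalModule.ring_smul_apply,
      faceMonomial_mul_of_disjoint Finset.sdiff_disjoint, Finset.sdiff_union_of_subset hTF] at h'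
    exact hφF h'
  -- A preimage of `x_F` would give `x_F ∈ a R`, on which `φ` vanishes.
  · obtain ⟨x, -, hx⟩ := hsurj (inl (Δ.faceMonomial k F))
      ⟨hΔ.pure F hF ▸ faceMonomial_mem_gradingA F, zero_mem _⟩
    refine hφF ?_
    have h := congrArg fst hx
    rw [fst_mul, fst_inl] at h
    rw [← h, ← CanonicalModule.ring_smul_apply, haφ]
    rfl

end SimplicialCx

theorem corollary5p2 {k : Type*} [Field k] [CharZero k] {V : Type*} [Fintype V] [DecidableEq V]
    (d : ℕ) (hd : 2 ≤ d) (Δ : SimplicialCx V)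
    (hΔ : Δ.IsPseudomanifoldWithoutBoundary (d - 1))
    (hbip : (Δ.dualGraph (d - 1)).IsBipartite) :
    IsArtinianGorenstein (idealizationGrading (Δ.gradingA k) (-(d : ℤ) - 1)) ∧
      ¬ HasWLPInDegree (idealizationGrading (Δ.gradingA k) (-(d : ℤ) - 1)) (d - 1) := by
  obtain ⟨e, rfl⟩ : ∃ e, d = e + 1 := ⟨d - 1, by omega⟩
  rw [Nat.add_sub_cancel] at hΔ hbip ⊢
  exact ⟨SimplicialCx.isArtinianGorenstein_idealization hΔ.pure,
    SimplicialCx.not_hasWLPInDegree_idealization (by omega) hΔ hbip⟩
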